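/- For positive integers $k_1,\ldots,k_n$ with $k_1>1$ let $$\zeta(k_1,\ldots,k_n)=\sum_{m_1>\cdots>m_n\ge 1}\frac{1}{m_1^{k_1}\cdots m_n^{k_n}},\qquad \zeta^{\star}(k_1,\ldots,k_n)=\sum_{m_1\ge\cdots\ge m_n\ge 1}\frac{1}{m_1^{k_1}\cdots m_n^{k_n}},$$ and let $\zeta(s)$ be the Riemann zeta function, so that $\zeta(0)=-\tfrac12$. Let $n$ be a positive integer and let $F(x_1,\ldots,x_n)\in\mathbb{Q}[x_1,\ldots,x_n]$ be a symmetric polynomial of (total) degree $r$ (with $r=0$ if $F=0$). Put $T=\max\{\lfloor (r+n-2)/2\rfloor,\lfloor (n-1)/2\rfloor\}$. Then there are polynomials $c_{F,l}(x),c^{\star}_{F,l}(x)\in\mathbb{Q}[x]$ for $0\le l\le T$, depending only on $l$ and $F$ (in particular not on $k$), with $$\deg c_{F,l}(x)\le r+n-2l-1,\qquad \deg c^{\star}_{F,l}(x)\le r+n-2l-1,$$ such that for every integer $k\ge n$ $$\sum_{\substack{k_1+\cdots+k_n=k\\ k_j\ge 1}}F(k_1,\ldots,k_n)\,\zeta(2k_1,\ldots,2k_n)=\sum_{l=0}^{\min\{T,k\}}c_{F,l}(k)\,\zeta(2l)\,\zeta(2k-2l)$$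 and $$\sum_{\substack{k_1+\cdots+k_n=k\\ k_j\ge 1}}F(k_1,\ldots,k_n)\,\zeta^{\star}(2k_1,\ldots,2k_n)=\sum_{l=0}^{\min\{T,k\}}c^{\star}_{F,l}(k)\,\zeta(2l)\,\zeta(2k-2l).$$ -/

import Mathlib

open scoped Polynomial

/-- The multiple zeta value
`ζ(k₁, …, kₙ) = ∑_{m₁ > ⋯ > mₙ ≥ 1} 1 / (m₁ ^ k₁ ⋯ mₙ ^ kₙ)`. -/
noncomputable def multiZeta {n : ℕ} (k : Fin n → ℕ) : ℝ :=
  ∑' m : {m : Fin n → ℕ // StrictAnti m ∧ ∀ i, 1 ≤ m i}, 1 / ∏ i, (m.1 i : ℝ) ^ k i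

/-- The multiple zeta-star value
`ζ⋆(k₁, …, kₙ) = ∑_{m₁ ≥ ⋯ ≥ mₙ ≥ 1} 1 / (m₁ ^ k₁ ⋯ mₙ ^ kₙ)`. -/
noncomputable def multiZetaStar {n : ℕ} (k : Fin n → ℕ) : ℝ :=
  ∑' m : {m : Fin n → ℕ // Antitone m ∧ ∀ i, 1 ≤ m i}, 1 / ∏ i, (m.1 i : ℝ) ^ k i

/-- The compositions `k₁ + ⋯ + kₙ = k` of `k` into `n` positive parts. -/
def positiveCompositions (n k : ℕ) : Finset (Fin n → ℕ) :=
  (Finset.Nat.antidiagonalTuple n k).filter (fun κ => ∀ i, 1 ≤ κ i)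

theorem mem_positiveCompositions {n k : ℕ} {κ : Fin n → ℕ} :
    κ ∈ positiveCompositions n k ↔ ∑ i, κ i = k ∧ ∀ i, 1 ≤ κ i := by
  simp [positiveCompositions, Finset.Nat.mem_antidiagonalTuple]

/-- The series of `1 / (m₁ ^ k₁ ⋯ mₙ ^ kₙ)` over all tuples converges when every `kᵢ ≥ 2`. -/
theorem summable_one_div_prod_pow {n : ℕ} (k : Fin n → ℕ) (hk : ∀ i, 2 ≤ k i) :
    Summable (fun m : Fin n → ℕ => 1 / ∏ i, (m i : ℝ) ^ k i) := by
  induction n with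
  | zero => exact (hasSum_fintype _).summable
  | succ n ih =>
    have h0 : Summable (fun a : ℕ => 1 / (a : ℝ) ^ k 0) :=
      Real.summable_one_div_nat_pow.2 (hk 0)
    have h1 := ih (fun i => k i.succ) (fun i => hk i.succ)
    have h2 := h0.mul_of_nonneg h1 (fun a => by positivity) (fun m => by positivity)
    rw [← (Fin.consEquiv (fun _ : Fin (n + 1) => ℕ)).summable_iff]
    refine h2.congr (fun p => ?_)
    simp [Fin.prod_univ_succ, Fin.consEquiv, mul_comm]

/-- The series defining `multiZeta k` converges when every `kᵢ ≥ 2`. -/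
theorem summable_multiZeta {n : ℕ} (k : Fin n → ℕ) (hk : ∀ i, 2 ≤ k i) :
    Summable (fun m : {m : Fin n → ℕ // StrictAnti m ∧ ∀ i, 1 ≤ m i} =>
      1 / ∏ i, (m.1 i : ℝ) ^ k i) :=
  (summable_one_div_prod_pow k hk).comp_injective Subtype.val_injective

/-- The series defining `multiZetaStar k` converges when every `kᵢ ≥ 2`. -/
theorem summable_multiZetaStar {n : ℕ} (k : Fin n → ℕ) (hk : ∀ i, 2 ≤ k i) :
    Summable (fun m : {m : Fin n → ℕ // Antitone m ∧ ∀ i, 1 ≤ m i} =>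
      1 / ∏ i, (m.1 i : ℝ) ^ k i) :=
  (summable_one_div_prod_pow k hk).comp_injective Subtype.val_injective

/-!
Let `ε = -1` for multiple zeta values and `ε = 1` for multiple zeta-star values. Since the weight
`F` is symmetric, each value may be replaced by its average over the permutations of its arguments,
that is, by `symZeta ε` divided by `n!` (`sum_perm_multiZeta`, `sum_perm_multiZetaStar`,
`sum_eval_mul_eq_average`). The symmetrised values obey the recursion `symZeta_cons`: a new
summation variable is either independent of the others or coincides with one of them.

Hence the generating series in `t` of the weighted sums of `symZeta ε` can be computed one variable
at a time (`weightedSeries_cons`). Splitting off a variable multiplies by an iterated derivative of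
`g + 1/2`, where `g = ∑ ζ(2k) tᵏ` and derivatives are taken with respect to the Euler operator
`θ = t d/dt`; merging it with another one replaces the weights `xᵖ` and `y^q` by
`∑ a^q (x - a)ᵖ`, a polynomial in `x` of degree at most `p + q + 1`. All these series therefore lie
in `ℚ[u, g]` with `u = π² t`, which is closed under `θ` because of the Riccati equation
`θ g = g² + g / 2 + u / 4` of the cotangent (`eulerOp_zetaSeries`).

The precise bounds come from a finer filtration. Put `q = g² + u / 4`. The ideal generated by `q` is
stable under `θ`, and `θ g ≡ g / 2` modulo `q`. With `u` of weight 2 and `g` of weight 1, the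
elements of weight at most `n`, together with the multiples of `q` of weight at most `n + e`, form a
filtration compatible with products and with `θ` (`zetaFiltration`); the weighted sum of length `n`
and degree `r` lies in the piece with `e = r` (`weightedSeries_mem_zetaFiltration`). Such an element
is a combination of `uⁱ` with `2i ≤ n`, of `uⁱ g` with `2i + 1 ≤ n`, and of `uⁱ θʲ q` with
`2i + j + 2 ≤ n + r` (`zetaFiltration_le`). As `q = θ g - g / 2` and `π²ⁱ` is a rational multiple of
`ζ(2i)`, the `k`-th coefficients of the last two kinds are `ζ(2i) ζ(2k - 2i)` times a polynomial in
`k` of the required degree, while the first kind does not contribute for `k ≥ n`.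
-/

open Finset.HasAntidiagonal (antidiagonal mem_antidiagonal)

/-! ### Symmetrised multiple zeta values -/

/-- The weight `∏ᵢ (1 + ε · #{j > i : mⱼ = mᵢ})` of a tuple `m`. For `ε = -1` it is the indicator
function of injective tuples, for `ε = 1` it is the product of the factorials of the
multiplicities of the entries of `m`. -/
def tupleWeight (ε : ℝ) {n : ℕ} (m : Fin n → ℕ) : ℝ :=
  ∏ i, (1 + ε * ∑ j, if i < j ∧ m j = m i then 1 else 0)

/-- The sum of `tupleWeight ε m / (m₁ ^ κ₁ ⋯ mₙ ^ κₙ)` over all tuples `m` of natural numbers. The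
tuples with an entry `0` contribute nothing as soon as every `κᵢ` is positive, since `1 / 0 = 0`.
For `ε = -1` and `ε = 1` this is the sum over all permutations of `κ` of the multiple zeta
values and of the multiple zeta-star values, respectively. -/
noncomputable def symZeta (ε : ℝ) {n : ℕ} (κ : Fin n → ℕ) : ℝ :=
  ∑' m : Fin n → ℕ, tupleWeight ε m * (1 / ∏ i, (m i : ℝ) ^ κ i)

theorem tupleWeight_cons (ε : ℝ) {n : ℕ} (b : ℕ) (m : Fin n → ℕ) :
    tupleWeight ε (Fin.cons b m : Fin (n + 1) → ℕ) =
      (1 + ε * ∑ j, if m j = b then 1 else 0) * tupleWeight ε m := by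
  simp only [tupleWeight, Fin.prod_univ_succ, Fin.sum_univ_succ, Fin.cons_zero, Fin.cons_succ,
    Fin.succ_lt_succ_iff, Fin.succ_pos, Fin.not_lt_zero, false_and, true_and, if_false,
    zero_add]

theorem abs_tupleWeight_le (ε : ℝ) {n : ℕ} (m : Fin n → ℕ) :
    |tupleWeight ε m| ≤ (1 + |ε| * n) ^ n := by
  rw [tupleWeight, Finset.abs_prod]
  refine (Finset.prod_le_prod (fun i _ => abs_nonneg _)
    (g := fun _ => 1 + |ε| * n) fun i _ => ?_).trans (by simp)
  refine (abs_add_le _ _).trans ?_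
  rw [abs_one, abs_mul]
  gcongr
  rw [abs_of_nonneg (Finset.sum_nonneg fun j _ => by split_ifs <;> norm_num)]
  refine (Finset.sum_le_card_nsmul _ _ 1 fun j _ => by split_ifs <;> norm_num).trans (by simp)

theorem tupleWeight_neg_one {n : ℕ} (m : Fin n → ℕ) [Decidable (Function.Injective m)] :
    tupleWeight (-1) m = if Function.Injective m then 1 else 0 := by
  classical
  induction n with
  | zero => simp [tupleWeight, Function.injective_of_subsingleton]
  | succ n ih =>
    obtain ⟨b, m, rfl⟩ : ∃ b m', m = (Fin.cons b m' : Fin (n + 1) → ℕ) :=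
      ⟨m 0, Fin.tail m, (Fin.cons_self_tail m).symm⟩
    rw [tupleWeight_cons, ih]
    by_cases hm : Function.Injective m
    · by_cases hb : b ∈ Set.range m
      · obtain ⟨j, rfl⟩ := hb
        simp [Fin.cons_injective_iff, hm, hm.eq_iff]
      · have h0 : ∀ j, m j ≠ b := fun j hj => hb ⟨j, hj⟩
        simp [Fin.cons_injective_iff, hm, h0]
    · simp [Fin.cons_injective_iff, hm]

open Nat in
/-- The product of the factorials of the multiplicities of `m`, over any finite set `s` that contains
the entries of `m`. -/
theorem prod_factorial_card_fiber {n : ℕ} (m : Fin n → ℕ) (s : Finset ℕ) (hs : ∀ i, m i ∈ s) :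
    ((∏ v ∈ s, (Fintype.card {i // m i = v})! : ℕ) : ℝ) = tupleWeight 1 m := by
  induction n with
  | zero => simp [tupleWeight]
  | succ n ih =>
    obtain ⟨b, m, rfl⟩ : ∃ b m', m = (Fin.cons b m' : Fin (n + 1) → ℕ) :=
      ⟨m 0, Fin.tail m, (Fin.cons_self_tail m).symm⟩
    have hb : b ∈ s := hs 0
    have key : ∀ v, (Fintype.card {i // (Fin.cons b m : Fin (n + 1) → ℕ) i = v})! =
        (Fintype.card {i // m i = v})! *
          if v = b then Fintype.card {i // m i = b} + 1 else 1 := by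
      intro v
      have h1 : Fintype.card {i // (Fin.cons b m : Fin (n + 1) → ℕ) i = v} =
          (if b = v then 1 else 0) + Fintype.card {i // m i = v} := by
        simp only [Fintype.card_subtype, Finset.card_filter, Fin.sum_univ_succ, Fin.cons_zero,
          Fin.cons_succ]
      rw [h1]
      by_cases h : v = b
      · subst h
        simp [add_comm 1, Nat.factorial_succ, mul_comm]
      · simp [h, Ne.symm h]
    rw [tupleWeight_cons, ← ih m fun i => hs i.succ]
    simp only [key, Finset.prod_mul_distrib, Finset.prod_ite_eq', hb, if_true]
    push_cast
    rw [Fintype.card_subtype, Finset.card_filter]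
    push_cast
    ring

theorem card_perm_antitone_comp {n : ℕ} (m : Fin n → ℕ)
    [DecidablePred fun σ : Equiv.Perm (Fin n) => Antitone (m ∘ σ)] :
    ((Finset.univ.filter fun σ : Equiv.Perm (Fin n) => Antitone (m ∘ σ)).card : ℝ) =
      tupleWeight 1 m := by
  classical
  rw [← prod_factorial_card_fiber m (Finset.univ.image m) (by simp), ← DomMulAct.stabilizer_card' m,
    Fintype.card_subtype]
  obtain ⟨τ, hτ⟩ : ∃ τ : Equiv.Perm (Fin n), Antitone (m ∘ τ) :=
    ⟨Tuple.sort (OrderDual.toDual ∘ m), Tuple.monotone_sort (OrderDual.toDual ∘ m)⟩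
  congr 1
  refine Finset.card_nbij' (fun σ => σ * τ⁻¹) (fun σ => σ * τ) ?_ ?_ ?_ ?_
  · intro σ hσ
    simp only [Finset.coe_filter, Finset.mem_univ, true_and, Set.mem_ofPred_eq] at hσ ⊢
    have h := Tuple.unique_antitone hσ hτ
    ext i
    have := congrFun h (τ⁻¹ i)
    simpa using this
  · intro σ hσ
    simp only [Finset.coe_filter, Finset.mem_univ, true_and, Set.mem_ofPred_eq] at hσ ⊢
    have : m ∘ (σ * τ : Equiv.Perm (Fin n)) = m ∘ τ := by
      ext i
      exact congrFun hσ (τ i)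
    rwa [this]
  · intro σ _
    simp
  · intro σ _
    simp

theorem card_perm_strictAnti_comp {n : ℕ} (m : Fin n → ℕ)
    [DecidablePred fun σ : Equiv.Perm (Fin n) => StrictAnti (m ∘ σ)] :
    ((Finset.univ.filter fun σ : Equiv.Perm (Fin n) => StrictAnti (m ∘ σ)).card : ℝ) =
      tupleWeight (-1) m := by
  classical
  rw [tupleWeight_neg_one]
  split_ifs with h
  · obtain ⟨τ, hτ⟩ : ∃ τ : Equiv.Perm (Fin n), Antitone (m ∘ τ) :=
      ⟨Tuple.sort (OrderDual.toDual ∘ m), Tuple.monotone_sort (OrderDual.toDual ∘ m)⟩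
    rw [Nat.cast_eq_one, Finset.card_eq_one]
    refine ⟨τ, Finset.eq_singleton_iff_unique_mem.2 ⟨?_, ?_⟩⟩
    · simpa using hτ.strictAnti_of_injective (h.comp τ.injective)
    · intro σ hσ
      have hσ' : StrictAnti (m ∘ σ) := by simpa using hσ
      ext i
      have := congrFun (Tuple.unique_antitone hσ'.antitone hτ) i
      rw [h this]
  · rw [Nat.cast_eq_zero, Finset.card_eq_zero, Finset.filter_eq_empty_iff]
    intro σ _ hσ
    refine h fun i j hij => ?_
    have := hσ.injective (a₁ := σ⁻¹ i) (a₂ := σ⁻¹ j) (by simpa using hij)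
    simpa using this

/-- Summing a series over tuples subject to a condition `P` over all permutations of the exponents
counts each tuple as often as it can be rearranged to satisfy `P`. -/
theorem sum_perm_tsum_subtype {n : ℕ} (P : (Fin n → ℕ) → Prop) (κ : Fin n → ℕ)
    (hκ : ∀ i, 2 ≤ κ i)
    [∀ m : Fin n → ℕ, DecidablePred fun σ : Equiv.Perm (Fin n) => P (m ∘ σ)] :
    ∑ σ : Equiv.Perm (Fin n),
      ∑' m : {m : Fin n → ℕ // P m ∧ ∀ i, 1 ≤ m i}, 1 / ∏ i, (m.1 i : ℝ) ^ κ (σ i) =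
    ∑' m : Fin n → ℕ, ((Finset.univ.filter fun σ : Equiv.Perm (Fin n) => P (m ∘ σ)).card : ℝ) *
      (1 / ∏ i, (m i : ℝ) ^ κ i) := by
  classical
  have h0 := summable_one_div_prod_pow κ hκ
  have h1 : ∀ σ : Equiv.Perm (Fin n),
      ∑' m : {m : Fin n → ℕ // P m ∧ ∀ i, 1 ≤ m i}, 1 / ∏ i, (m.1 i : ℝ) ^ κ (σ i) =
      ∑' m : Fin n → ℕ, if P (m ∘ σ) then 1 / ∏ i, (m i : ℝ) ^ κ i else 0 := by
    intro σ
    have h2 := tsum_subtype {m : Fin n → ℕ | P m ∧ ∀ i, 1 ≤ m i}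
      (fun m => 1 / ∏ i, (m i : ℝ) ^ κ (σ i))
    refine h2.trans ?_
    rw [← (Equiv.arrowCongr σ.symm (Equiv.refl ℕ)).tsum_eq]
    refine tsum_congr fun m => ?_
    have h3 : (Equiv.arrowCongr σ.symm (Equiv.refl ℕ)) m = m ∘ σ := by
      ext i
      simp [Equiv.arrowCongr]
    have h4 : ∏ i, ((m ∘ σ) i : ℝ) ^ κ (σ i) = ∏ i, (m i : ℝ) ^ κ i :=
      Equiv.prod_comp σ fun i => (m i : ℝ) ^ κ i
    rw [h3, Set.indicator_apply, h4]
    simp only [Set.mem_ofPred_eq]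
    by_cases hP : P (m ∘ σ)
    · by_cases hm : ∀ i, 1 ≤ (m ∘ σ) i
      · rw [if_pos ⟨hP, hm⟩, if_pos hP]
      · rw [if_neg fun h => hm h.2, if_pos hP]
        push Not at hm
        obtain ⟨i, hi⟩ := hm
        rw [Finset.prod_eq_zero (Finset.mem_univ (σ i)), div_zero]
        have : m (σ i) = 0 := by simpa using hi
        rw [this, Nat.cast_zero, zero_pow (by have := hκ (σ i); omega)]
    · rw [if_neg fun h => hP h.1, if_neg hP]
  simp_rw [h1]
  rw [← Summable.tsum_finsetSum]
  · refine tsum_congr fun m => ?_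
    rw [← Finset.sum_filter, Finset.sum_const, nsmul_eq_mul]
  · intro σ _
    refine h0.of_nonneg_of_le (fun m => ?_) fun m => ?_
    · split_ifs
      · positivity
      · rfl
    · split_ifs
      · rfl
      · positivity

theorem sum_perm_multiZeta {n : ℕ} (κ : Fin n → ℕ) (hκ : ∀ i, 2 ≤ κ i) :
    ∑ σ : Equiv.Perm (Fin n), multiZeta (fun i => κ (σ i)) = symZeta (-1) κ := by
  classical
  refine (sum_perm_tsum_subtype StrictAnti κ hκ).trans (tsum_congr fun m => ?_)
  rw [card_perm_strictAnti_comp]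

theorem sum_perm_multiZetaStar {n : ℕ} (κ : Fin n → ℕ) (hκ : ∀ i, 2 ≤ κ i) :
    ∑ σ : Equiv.Perm (Fin n), multiZetaStar (fun i => κ (σ i)) = symZeta 1 κ := by
  classical
  refine (sum_perm_tsum_subtype Antitone κ hκ).trans (tsum_congr fun m => ?_)
  rw [card_perm_antitone_comp]

theorem summable_symZeta (ε : ℝ) {n : ℕ} (κ : Fin n → ℕ) (hκ : ∀ i, 2 ≤ κ i) :
    Summable fun m : Fin n → ℕ => tupleWeight ε m * (1 / ∏ i, (m i : ℝ) ^ κ i) := by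
  refine ((summable_one_div_prod_pow κ hκ).mul_left ((1 + |ε| * n) ^ n)).of_norm_bounded
    fun m => ?_
  rw [norm_mul, Real.norm_eq_abs, Real.norm_of_nonneg (by positivity)]
  gcongr
  exact abs_tupleWeight_le ε m

theorem symZeta_zero (ε : ℝ) (κ : Fin 0 → ℕ) : symZeta ε κ = 1 := by
  rw [symZeta, tsum_fintype]
  simp [tupleWeight]

/-- The stuffle-type recursion of the symmetrised zeta values: a new summation variable is either
independent of the others or merged with one of them. -/
theorem symZeta_cons (ε : ℝ) {n : ℕ} (a : ℕ) (κ : Fin n → ℕ) (ha : 2 ≤ a) (hκ : ∀ i, 2 ≤ κ i) :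
    symZeta ε (Fin.cons a κ : Fin (n + 1) → ℕ) =
      (∑' b : ℕ, 1 / (b : ℝ) ^ a) * symZeta ε κ +
        ε * ∑ j, symZeta ε (κ + Pi.single j a) := by
  have hcons : ∀ i, 2 ≤ (Fin.cons a κ : Fin (n + 1) → ℕ) i := Fin.cases ha hκ
  have hS := summable_symZeta ε _ hcons
  set f : (Fin n → ℕ) → ℝ := fun m => tupleWeight ε m * (1 / ∏ i, (m i : ℝ) ^ κ i) with hf
  have hSf : Summable f := summable_symZeta ε κ hκ
  have hSa : Summable fun b : ℕ => 1 / (b : ℝ) ^ a := Real.summable_one_div_nat_pow.2 ha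
  have hterm : ∀ (b : ℕ) (m : Fin n → ℕ),
      tupleWeight ε (Fin.cons b m : Fin (n + 1) → ℕ) *
        (1 / ∏ i, (((Fin.cons b m : Fin (n + 1) → ℕ) i : ℕ) : ℝ) ^
          (Fin.cons a κ : Fin (n + 1) → ℕ) i) =
      1 / (b : ℝ) ^ a * f m +
        ε * ∑ j, if m j = b then 1 / (b : ℝ) ^ a * f m else 0 := by
    intro b m
    rw [tupleWeight_cons, Fin.prod_univ_succ]
    simp only [Fin.cons_zero, Fin.cons_succ, hf]
    have : (∑ j, if m j = b then 1 / (b : ℝ) ^ a *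
          (tupleWeight ε m * (1 / ∏ i, (m i : ℝ) ^ κ i)) else 0) =
        (∑ j, if m j = b then (1 : ℝ) else 0) * (1 / (b : ℝ) ^ a *
          (tupleWeight ε m * (1 / ∏ i, (m i : ℝ) ^ κ i))) := by
      rw [Finset.sum_mul]
      exact Finset.sum_congr rfl fun j _ => by split_ifs <;> simp
    rw [this, one_div_mul_eq_div (_ : ℝ), ← one_div_mul_one_div]
    ring
  have hmerge : ∀ (j : Fin n) (m : Fin n → ℕ), 1 / (m j : ℝ) ^ a * f m =
      tupleWeight ε m * (1 / ∏ i, (m i : ℝ) ^ (κ + Pi.single j a : Fin n → ℕ) i) := by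
    intro j m
    have : ∏ i, (m i : ℝ) ^ (κ + Pi.single j a : Fin n → ℕ) i =
        (∏ i, (m i : ℝ) ^ κ i) * (m j : ℝ) ^ a := by
      simp only [Pi.add_apply, pow_add, Finset.prod_mul_distrib]
      congr 1
      rw [Finset.prod_eq_single j]
      · simp
      · intro i _ hij
        simp [Pi.single_eq_of_ne hij]
      · simp
    rw [this, hf, ← one_div_mul_one_div]
    ring
  have hSj : ∀ j, Summable fun m : Fin n → ℕ => 1 / (m j : ℝ) ^ a * f m := by
    intro j
    simp_rw [hmerge j]
    exact summable_symZeta ε _ fun i => (hκ i).trans (by simp)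
  have hSsum : Summable fun m : Fin n → ℕ => ε * ∑ j, 1 / (m j : ℝ) ^ a * f m :=
    (summable_sum fun j _ => hSj j).mul_left ε
  let e : (Fin n → ℕ) × ℕ ≃ (Fin (n + 1) → ℕ) :=
    (Equiv.prodComm _ _).trans (Fin.consEquiv (fun _ : Fin (n + 1) => ℕ))
  have hinner : ∀ m : Fin n → ℕ,
      ∑' b : ℕ, tupleWeight ε (e (m, b)) *
        (1 / ∏ i, ((e (m, b) i : ℕ) : ℝ) ^ (Fin.cons a κ : Fin (n + 1) → ℕ) i) =
      (∑' b : ℕ, 1 / (b : ℝ) ^ a) * f m + ε * ∑ j, 1 / (m j : ℝ) ^ a * f m := by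
    intro m
    have hj : ∀ j, HasSum (fun b => if m j = b then 1 / (b : ℝ) ^ a * f m else 0)
        (1 / (m j : ℝ) ^ a * f m) := fun j => by
      have h := hasSum_single (f := fun b : ℕ => if m j = b then 1 / (b : ℝ) ^ a * f m else 0)
        (m j) fun b hb => if_neg hb.symm
      simpa using h
    have h := (hSa.hasSum.mul_right (f m)).add
      ((hasSum_sum (s := Finset.univ) fun j _ => hj j).mul_left ε)
    exact (tsum_congr fun b => hterm b m).trans h.tsum_eq
  have hS' := e.summable_iff.2 hS
  rw [symZeta, ← e.tsum_eq]
  refine (hS'.tsum_prod).trans ?_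
  refine (tsum_congr hinner).trans ?_
  rw [Summable.tsum_add (hSf.mul_left _) hSsum, tsum_mul_left, tsum_mul_left,
    Summable.tsum_finsetSum fun j _ => hSj j]
  simp_rw [hmerge]
  rfl

/-! ### The generating series of even zeta values -/

open PowerSeries in
/-- The differential equation `B² = B - tB - tB'` of `B = t / (eᵗ - 1)`, obtained by differentiating
`B (eᵗ - 1) = t`. -/
theorem bernoulliPowerSeries_sq :
    bernoulliPowerSeries ℚ ^ 2 = bernoulliPowerSeries ℚ - X * bernoulliPowerSeries ℚ -
      X * derivative ℚ (bernoulliPowerSeries ℚ) := by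
  have h := bernoulliPowerSeries_mul_exp_sub_one ℚ
  have h' := congrArg (derivative ℚ) h
  rw [Derivation.leibniz, map_sub, derivative_exp, derivative_one, derivative_X, smul_eq_mul,
    smul_eq_mul] at h'
  linear_combination bernoulliPowerSeries ℚ * h' -
    (derivative ℚ (bernoulliPowerSeries ℚ) + bernoulliPowerSeries ℚ) * h

/-- Euler's convolution identity for the Bernoulli numbers of even index. -/
theorem sum_antidiagonal_bernoulli (k : ℕ) :
    ∑ p ∈ antidiagonal k, (bernoulli (2 * p.1) / (2 * p.1).factorial : ℚ) *
        (bernoulli (2 * p.2) / (2 * p.2).factorial) =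
      (1 - 2 * k) * (bernoulli (2 * k) / (2 * k).factorial) + if k = 1 then 1 / 4 else 0 := by
  -- Adding `X / 2` to the Bernoulli series removes its only coefficient of odd index.
  set A : PowerSeries ℚ :=
    bernoulliPowerSeries ℚ + PowerSeries.C (1 / 2 : ℚ) * PowerSeries.X with hA
  have hC : (PowerSeries.C (1 / 2 : ℚ)) * 2 = 1 := by
    rw [← map_ofNat (PowerSeries.C (R := ℚ)) 2, ← map_mul]
    norm_num
  have hA2 : A * A = A - PowerSeries.X * PowerSeries.derivative ℚ A +
      PowerSeries.C (1 / 4 : ℚ) * PowerSeries.X ^ 2 := by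
    have h4 : (PowerSeries.C (1 / 4 : ℚ)) = PowerSeries.C (1 / 2 : ℚ) * PowerSeries.C (1 / 2) := by
      rw [← map_mul]
      norm_num
    have hd : PowerSeries.derivative ℚ A =
        PowerSeries.derivative ℚ (bernoulliPowerSeries ℚ) + PowerSeries.C (1 / 2 : ℚ) := by
      rw [hA, map_add, Derivation.leibniz, PowerSeries.derivative_C, PowerSeries.derivative_X]
      simp
    rw [hd, h4, hA]
    linear_combination bernoulliPowerSeries_sq +
      bernoulliPowerSeries ℚ * PowerSeries.X * hC
  have hcoeff : ∀ i, PowerSeries.coeff i A =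
      bernoulli i / i.factorial + if i = 1 then 1 / 2 else 0 := by
    intro i
    simp [hA, bernoulliPowerSeries, PowerSeries.coeff_X]
  have hodd : ∀ i, ¬ 2 ∣ i → PowerSeries.coeff i A = 0 := by
    intro i hi
    rw [hcoeff]
    rcases eq_or_ne i 1 with rfl | h1
    · norm_num [bernoulli_one]
    · rw [bernoulli_eq_zero_of_odd (by simpa [← even_iff_two_dvd] using hi) (by omega), if_neg h1]
      simp
  have heven : ∀ i, PowerSeries.coeff (2 * i) A = bernoulli (2 * i) / (2 * i).factorial := by
    intro i
    rw [hcoeff, if_neg (by omega), add_zero]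
  have h := congrArg (PowerSeries.coeff (2 * k)) hA2
  rw [PowerSeries.coeff_mul] at h
  have hsum : ∑ p ∈ antidiagonal k, (bernoulli (2 * p.1) / (2 * p.1).factorial : ℚ) *
        (bernoulli (2 * p.2) / (2 * p.2).factorial) =
      ∑ p ∈ antidiagonal (2 * k), PowerSeries.coeff p.1 A * PowerSeries.coeff p.2 A := by
    refine Finset.sum_of_injOn (fun p => (2 * p.1, 2 * p.2)) ?_ ?_ ?_ ?_
    · rintro ⟨a, b⟩ _ ⟨c, d⟩ _ h
      simpa using h
    · rintro ⟨a, b⟩ h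
      simp only [Finset.mem_coe, mem_antidiagonal] at h ⊢
      omega
    · rintro ⟨a, b⟩ h h'
      rw [mem_antidiagonal] at h
      rw [hodd a, zero_mul]
      rintro ⟨c, rfl⟩
      refine h' ⟨(c, b / 2), ?_, ?_⟩
      · simp only [Finset.mem_coe, mem_antidiagonal]
        omega
      · simp only [Prod.mk.injEq, true_and]
        omega
    · rintro ⟨a, b⟩ _
      rw [heven, heven]
  rw [hsum, h]
  have hX : PowerSeries.coeff (2 * k) (PowerSeries.X * PowerSeries.derivative ℚ A) =
      2 * k * PowerSeries.coeff (2 * k) A := by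
    cases k with
    | zero => simp
    | succ k =>
      rw [show 2 * (k + 1) = 2 * k + 1 + 1 by ring, PowerSeries.coeff_succ_X_mul,
        PowerSeries.coeff_derivative]
      push_cast
      ring
  rw [map_add, map_sub, hX, heven, PowerSeries.coeff_C_mul, PowerSeries.coeff_X_pow]
  have : (2 * k = 2) ↔ k = 1 := by omega
  simp only [this]
  split_ifs <;> ring

/-- The value `ζ(2k)`, given by Euler's formula; in particular `ζ(0) = -1/2`. -/
noncomputable def zetaEven (k : ℕ) : ℝ :=
  (-1) ^ (k + 1) * (2 * Real.pi) ^ (2 * k) * (bernoulli (2 * k) / (2 * k).factorial : ℚ) / 2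

theorem zetaEven_zero : zetaEven 0 = -1 / 2 := by
  simp [zetaEven]

theorem tsum_one_div_pow_two_mul {k : ℕ} (hk : k ≠ 0) :
    ∑' b : ℕ, 1 / (b : ℝ) ^ (2 * k) = zetaEven k := by
  rw [(hasSum_zeta_nat hk).tsum_eq, zetaEven]
  have : (2 : ℝ) ^ (2 * k) = 2 ^ (2 * k - 1) * 2 := by
    rw [← pow_succ]
    congr 1
    omega
  rw [mul_pow, this]
  push_cast
  ring

theorem riemannZeta_two_mul_eq_zetaEven (k : ℕ) : riemannZeta (2 * (k : ℂ)) = (zetaEven k : ℂ) := by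
  rcases eq_or_ne k 0 with rfl | hk
  · norm_num [riemannZeta_zero, zetaEven_zero]
  · rw [riemannZeta_two_mul_nat hk, ← tsum_one_div_pow_two_mul hk, (hasSum_zeta_nat hk).tsum_eq]
    push_cast
    rfl

/-- Euler's formula read backwards; `ζ(2k) ≠ 0` replaces the nonvanishing of Bernoulli numbers. -/
theorem exists_pi_pow_eq_mul_zetaEven (k : ℕ) :
    ∃ ρ : ℚ, (Real.pi ^ 2) ^ k = (ρ : ℝ) * zetaEven k := by
  have h0 : zetaEven k ≠ 0 := by
    intro h
    rcases eq_or_ne k 0 with rfl | hk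
    · norm_num [zetaEven_zero] at h
    · have h1 := riemannZeta_two_mul_eq_zetaEven k
      rw [h, Complex.ofReal_zero] at h1
      refine riemannZeta_ne_zero_of_one_le_re (s := 2 * (k : ℂ)) ?_ h1
      have : (1 : ℝ) ≤ k := by exact_mod_cast Nat.one_le_iff_ne_zero.2 hk
      simp
      linarith
  set q : ℚ := (-1) ^ (k + 1) * 2 ^ (2 * k) * (bernoulli (2 * k) / (2 * k).factorial) / 2 with hq
  have hz : zetaEven k = q * (Real.pi ^ 2) ^ k := by
    rw [zetaEven, hq, mul_pow, pow_mul Real.pi]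
    push_cast
    ring
  have hq0 : (q : ℝ) ≠ 0 := fun h => h0 (by rw [hz, h, zero_mul])
  refine ⟨q⁻¹, ?_⟩
  rw [hz]
  push_cast
  rw [inv_mul_cancel_left₀ hq0]

theorem sum_antidiagonal_zetaEven (k : ℕ) :
    ∑ p ∈ antidiagonal k, zetaEven p.1 * zetaEven p.2 =
      (k - 1 / 2) * zetaEven k - if k = 1 then Real.pi ^ 2 / 4 else 0 := by
  have h := congrArg (fun x : ℚ => (x : ℝ)) (sum_antidiagonal_bernoulli k)
  simp only [Rat.cast_sum, Rat.cast_add, Rat.cast_mul (_ : ℚ) (_ : ℚ)] at h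
  have h1 : ∑ p ∈ antidiagonal k, zetaEven p.1 * zetaEven p.2 =
      (-1) ^ k * (2 * Real.pi) ^ (2 * k) / 4 *
        ∑ p ∈ antidiagonal k, ((bernoulli (2 * p.1) / (2 * p.1).factorial : ℚ) : ℝ) *
        ((bernoulli (2 * p.2) / (2 * p.2).factorial : ℚ) : ℝ) := by
    rw [Finset.mul_sum]
    refine Finset.sum_congr rfl fun p hp => ?_
    rw [← mem_antidiagonal.1 hp, zetaEven, zetaEven]
    ring
  rw [h1, h, zetaEven]
  split_ifs with hk
  · subst hk
    norm_num [bernoulli_two]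
    ring
  · push_cast
    ring

/-- The Euler operator `t · d/dt` on formal power series. -/
noncomputable def eulerOp : Derivation ℝ (PowerSeries ℝ) (PowerSeries ℝ) :=
  (PowerSeries.X : PowerSeries ℝ) • PowerSeries.derivative ℝ

/-- The generating series `∑ₖ ζ(2k) tᵏ = -(π √t / 2) cot (π √t)`. -/
noncomputable def zetaSeries : PowerSeries ℝ := PowerSeries.mk zetaEven

/-- The series `π² t`. -/
noncomputable def piSeries : PowerSeries ℝ := PowerSeries.C (Real.pi ^ 2) * PowerSeries.X

/-- The series `zetaSeries ^ 2 + π² t / 4`, which generates an ideal of `ℚ[π² t, zetaSeries]`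
stable under the Euler operator. -/
noncomputable def cotIdealGen : PowerSeries ℝ := zetaSeries ^ 2 + (1 / 4 : ℚ) • piSeries

theorem coeff_eulerOp (f : PowerSeries ℝ) (k : ℕ) :
    PowerSeries.coeff k (eulerOp f) = k * PowerSeries.coeff k f := by
  rw [eulerOp, Derivation.smul_apply, smul_eq_mul]
  cases k with
  | zero => simp
  | succ k =>
    rw [PowerSeries.coeff_succ_X_mul, PowerSeries.coeff_derivative]
    push_cast
    ring

theorem coeff_eulerOp_iterate (f : PowerSeries ℝ) (j k : ℕ) :
    PowerSeries.coeff k (eulerOp^[j] f) = (k : ℝ) ^ j * PowerSeries.coeff k f := by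
  induction j with
  | zero => simp
  | succ j ih =>
    rw [Function.iterate_succ_apply', coeff_eulerOp, ih]
    ring

theorem eulerOp_ratSMul (c : ℚ) (f : PowerSeries ℝ) : eulerOp (c • f) = c • eulerOp f :=
  map_ratCast_smul eulerOp ℝ ℝ c f

theorem eulerOp_piSeries : eulerOp piSeries = piSeries := by
  ext k
  rw [coeff_eulerOp, piSeries, PowerSeries.coeff_C_mul, PowerSeries.coeff_X]
  split_ifs with h
  · simp [h]
  · simp

theorem coeff_ratSMul (c : ℚ) (f : PowerSeries ℝ) (k : ℕ) :
    PowerSeries.coeff k (c • f) = c * PowerSeries.coeff k f := by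
  rw [map_rat_smul (PowerSeries.coeff k) c f, Rat.smul_def]

/-- The Riccati equation satisfied by the cotangent. -/
theorem eulerOp_zetaSeries : eulerOp zetaSeries = cotIdealGen + (1 / 2 : ℚ) • zetaSeries := by
  ext k
  rw [coeff_eulerOp, cotIdealGen, map_add, map_add, sq, PowerSeries.coeff_mul, coeff_ratSMul,
    coeff_ratSMul, piSeries, PowerSeries.coeff_C_mul, PowerSeries.coeff_X]
  simp only [zetaSeries, PowerSeries.coeff_mk, sum_antidiagonal_zetaEven]
  push_cast
  split_ifs <;> ring

theorem eulerOp_cotIdealGen :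
    eulerOp cotIdealGen = 2 * zetaSeries * cotIdealGen + cotIdealGen := by
  have h : eulerOp cotIdealGen = 2 * zetaSeries * eulerOp zetaSeries +
      (1 / 4 : ℚ) • piSeries := by
    rw [cotIdealGen, map_add, eulerOp_ratSMul, eulerOp_piSeries, sq, Derivation.leibniz,
      smul_eq_mul]
    ring
  rw [h, eulerOp_zetaSeries, cotIdealGen]
  algebra

/-! ### A filtration of the differential algebra generated by the zeta series -/

/-- With `u = π² t`, `g = zetaSeries` and `q = g² + u / 4`, the `ℚ`-span of the monomials `uⁱ gʲ` of
weight `2i + j ≤ n` and of the products `uⁱ gʲ q` of weight `2i + j + 2 ≤ n + e`. -/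
noncomputable def zetaFiltration (n e : ℕ) : Submodule ℚ (PowerSeries ℝ) :=
  Submodule.span ℚ
    ({x | ∃ i j, 2 * i + j ≤ n ∧ x = piSeries ^ i * zetaSeries ^ j} ∪
      {x | ∃ i j, 2 * i + j + 2 ≤ n + e ∧ x = piSeries ^ i * zetaSeries ^ j * cotIdealGen})

theorem monomial_mem_zetaFiltration {n i j : ℕ} (e : ℕ) (h : 2 * i + j ≤ n) :
    piSeries ^ i * zetaSeries ^ j ∈ zetaFiltration n e :=
  Submodule.subset_span (Or.inl ⟨i, j, h, rfl⟩)

theorem monomial_mul_cotIdealGen_mem_zetaFiltration {n e i j : ℕ} (h : 2 * i + j + 2 ≤ n + e) :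
    piSeries ^ i * zetaSeries ^ j * cotIdealGen ∈ zetaFiltration n e :=
  Submodule.subset_span (Or.inr ⟨i, j, h, rfl⟩)

theorem zetaFiltration_mono {n e n' e' : ℕ} (h : n ≤ n') (h' : n + e ≤ n' + e') :
    zetaFiltration n e ≤ zetaFiltration n' e' := by
  refine Submodule.span_le.2 ?_
  rintro _ (⟨i, j, hij, rfl⟩ | ⟨i, j, hij, rfl⟩)
  · exact monomial_mem_zetaFiltration e' (hij.trans h)
  · exact monomial_mul_cotIdealGen_mem_zetaFiltration (hij.trans h')

theorem mul_mem_zetaFiltration {a b e f : ℕ} {x y : PowerSeries ℝ} (hx : x ∈ zetaFiltration a e)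
    (hy : y ∈ zetaFiltration b f) : x * y ∈ zetaFiltration (a + b) (e + f) := by
  have h := Submodule.mul_mem_mul hx hy
  rw [zetaFiltration, zetaFiltration, Submodule.span_mul_span] at h
  refine Submodule.span_le.2 ?_ h
  rintro _ ⟨_, ⟨i, j, hij, rfl⟩ | ⟨i, j, hij, rfl⟩, _, ⟨i', j', hij', rfl⟩ | ⟨i', j', hij', rfl⟩, rfl⟩
  · rw [show (fun x1 x2 : PowerSeries ℝ => x1 * x2) (piSeries ^ i * zetaSeries ^ j)
      (piSeries ^ i' * zetaSeries ^ j') = piSeries ^ (i + i') * zetaSeries ^ (j + j') by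
        dsimp only
        ring]
    exact monomial_mem_zetaFiltration _ (by omega)
  · rw [show (fun x1 x2 : PowerSeries ℝ => x1 * x2) (piSeries ^ i * zetaSeries ^ j)
      (piSeries ^ i' * zetaSeries ^ j' * cotIdealGen) =
        piSeries ^ (i + i') * zetaSeries ^ (j + j') * cotIdealGen by
        dsimp only
        ring]
    exact monomial_mul_cotIdealGen_mem_zetaFiltration (by omega)
  · rw [show (fun x1 x2 : PowerSeries ℝ => x1 * x2) (piSeries ^ i * zetaSeries ^ j * cotIdealGen)
      (piSeries ^ i' * zetaSeries ^ j') =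
        piSeries ^ (i + i') * zetaSeries ^ (j + j') * cotIdealGen by
        dsimp only
        ring]
    exact monomial_mul_cotIdealGen_mem_zetaFiltration (by omega)
  · -- One of the two factors `q` is expanded as `g² + u / 4`.
    rw [show (fun x1 x2 : PowerSeries ℝ => x1 * x2) (piSeries ^ i * zetaSeries ^ j * cotIdealGen)
      (piSeries ^ i' * zetaSeries ^ j' * cotIdealGen) =
        piSeries ^ (i + i') * zetaSeries ^ (j + j' + 2) * cotIdealGen +
        (1 / 4 : ℚ) • (piSeries ^ (i + i' + 1) * zetaSeries ^ (j + j') * cotIdealGen) by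
        dsimp only
        nth_rw 2 [cotIdealGen]
        algebra]
    exact add_mem (monomial_mul_cotIdealGen_mem_zetaFiltration (by omega))
      (Submodule.smul_mem _ _ (monomial_mul_cotIdealGen_mem_zetaFiltration (by omega)))

theorem eulerOp_pow_mul (x : PowerSeries ℝ) (i : ℕ) :
    eulerOp (piSeries ^ i * x) = (i : ℚ) • (piSeries ^ i * x) + piSeries ^ i * eulerOp x := by
  have h : eulerOp (piSeries ^ i) = (i : ℚ) • piSeries ^ i := by
    cases i with
    | zero => simp
    | succ i =>
      rw [Derivation.leibniz_pow, eulerOp_piSeries, Nat.cast_smul_eq_nsmul]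
      simp [pow_succ]
  rw [Derivation.leibniz, h, smul_eq_mul, smul_eq_mul]
  algebra

theorem eulerOp_zetaSeries_pow (j : ℕ) :
    eulerOp (zetaSeries ^ (j + 1)) = (j + 1 : ℚ) • (zetaSeries ^ j * cotIdealGen) +
      ((j + 1) / 2 : ℚ) • zetaSeries ^ (j + 1) := by
  rw [Derivation.leibniz_pow, eulerOp_zetaSeries, ← Nat.cast_smul_eq_nsmul ℚ]
  simp only [smul_eq_mul, Nat.add_sub_cancel]
  push_cast
  algebra

theorem eulerOp_zetaSeries_pow_mul_cotIdealGen (j : ℕ) :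
    eulerOp (zetaSeries ^ j * cotIdealGen) =
      (j + 2 : ℚ) • (zetaSeries ^ (j + 1) * cotIdealGen) +
      (j / 2 + 1 : ℚ) • (zetaSeries ^ j * cotIdealGen) +
      (j / 4 : ℚ) • (piSeries * zetaSeries ^ (j - 1) * cotIdealGen) := by
  cases j with
  | zero =>
    rw [pow_zero, one_mul, eulerOp_cotIdealGen]
    simp only [Nat.cast_zero, zero_div, zero_smul]
    algebra
  | succ j =>
    rw [Derivation.leibniz, eulerOp_zetaSeries_pow, eulerOp_cotIdealGen, smul_eq_mul, smul_eq_mul,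
      Nat.add_sub_cancel]
    simp only [cotIdealGen]
    push_cast
    algebra

theorem eulerOp_mem_zetaFiltration {n e : ℕ} {x : PowerSeries ℝ} (hx : x ∈ zetaFiltration n e) :
    eulerOp x ∈ zetaFiltration n (e + 1) := by
  induction hx using Submodule.span_induction with
  | zero => simp
  | add x y _ _ hx hy =>
    rw [map_add]
    exact add_mem hx hy
  | smul c x _ hx =>
    rw [eulerOp_ratSMul]
    exact Submodule.smul_mem _ _ hx
  | mem x hx =>
    rcases hx with ⟨i, j, hij, rfl⟩ | ⟨i, j, hij, rfl⟩
    · rw [eulerOp_pow_mul]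
      refine add_mem (Submodule.smul_mem _ _ (monomial_mem_zetaFiltration _ hij)) ?_
      cases j with
      | zero => simp
      | succ j =>
        rw [eulerOp_zetaSeries_pow, mul_add, mul_smul_comm, mul_smul_comm, ← mul_assoc]
        exact add_mem (Submodule.smul_mem _ _
            (monomial_mul_cotIdealGen_mem_zetaFiltration (by omega)))
          (Submodule.smul_mem _ _ (monomial_mem_zetaFiltration _ hij))
    · rw [mul_assoc, eulerOp_pow_mul, eulerOp_zetaSeries_pow_mul_cotIdealGen]
      simp only [mul_add, mul_smul_comm, ← mul_assoc]
      refine add_mem (Submodule.smul_mem _ _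
          (monomial_mul_cotIdealGen_mem_zetaFiltration (by omega)))
        (add_mem (add_mem (Submodule.smul_mem _ _
          (monomial_mul_cotIdealGen_mem_zetaFiltration (by omega))) (Submodule.smul_mem _ _
          (monomial_mul_cotIdealGen_mem_zetaFiltration (by omega)))) ?_)
      cases j with
      | zero => simp
      | succ j =>
        rw [← pow_succ]
        exact Submodule.smul_mem _ _ (monomial_mul_cotIdealGen_mem_zetaFiltration (by omega))

theorem eulerOp_iterate_mem_zetaFiltration {n e : ℕ} {x : PowerSeries ℝ}
    (hx : x ∈ zetaFiltration n e) (j : ℕ) : eulerOp^[j] x ∈ zetaFiltration n (e + j) := by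
  induction j with
  | zero => exact hx
  | succ j ih =>
    rw [Function.iterate_succ_apply']
    exact eulerOp_mem_zetaFiltration ih

/-- The `ℚ`-span of the products `uⁱ θʲ q` of weight `2i + j + 2 ≤ w`, where `θ` is the Euler
operator. -/
noncomputable def eulerIterateSpan (w : ℕ) : Submodule ℚ (PowerSeries ℝ) :=
  Submodule.span ℚ {x | ∃ i j, 2 * i + j + 2 ≤ w ∧ x = piSeries ^ i * eulerOp^[j] cotIdealGen}

theorem eulerIterateSpan_mono {w w' : ℕ} (h : w ≤ w') :
    eulerIterateSpan w ≤ eulerIterateSpan w' := by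
  refine Submodule.span_le.2 ?_
  rintro _ ⟨i, j, hij, rfl⟩
  exact Submodule.subset_span ⟨i, j, hij.trans h, rfl⟩

theorem piSeries_pow_mul_mem_eulerIterateSpan {w : ℕ} {x : PowerSeries ℝ}
    (hx : x ∈ eulerIterateSpan w) (a : ℕ) : piSeries ^ a * x ∈ eulerIterateSpan (w + 2 * a) := by
  induction hx using Submodule.span_induction with
  | zero => simp
  | add x y _ _ hx hy =>
    rw [mul_add]
    exact add_mem hx hy
  | smul c x _ hx =>
    rw [mul_smul_comm]
    exact Submodule.smul_mem _ _ hx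
  | mem x hx =>
    obtain ⟨i, j, hij, rfl⟩ := hx
    exact Submodule.subset_span ⟨a + i, j, by omega, by ring⟩

theorem eulerOp_mem_eulerIterateSpan {w : ℕ} {x : PowerSeries ℝ} (hx : x ∈ eulerIterateSpan w) :
    eulerOp x ∈ eulerIterateSpan (w + 1) := by
  induction hx using Submodule.span_induction with
  | zero => simp
  | add x y _ _ hx hy =>
    rw [map_add]
    exact add_mem hx hy
  | smul c x _ hx =>
    rw [eulerOp_ratSMul]
    exact Submodule.smul_mem _ _ hx
  | mem x hx =>
    obtain ⟨i, j, hij, rfl⟩ := hx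
    rw [eulerOp_pow_mul, ← Function.iterate_succ_apply' eulerOp]
    exact add_mem (Submodule.smul_mem _ _ (Submodule.subset_span ⟨i, j, by omega, rfl⟩))
      (Submodule.subset_span ⟨i, j + 1, by omega, rfl⟩)

/-- Solving the formula for `θ (gʲ q)` for its leading term `gʲ⁺¹ q` shows by induction that the
ideal generated by `q` is spanned by the derivatives of `q`. -/
theorem zetaSeries_pow_mul_cotIdealGen_mem (j : ℕ) :
    zetaSeries ^ j * cotIdealGen ∈ eulerIterateSpan (j + 2) := by
  induction j using Nat.strong_induction_on with
  | _ j ih =>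
    cases j with
    | zero => exact Submodule.subset_span ⟨0, 0, by omega, by simp⟩
    | succ j =>
      have h := eulerOp_zetaSeries_pow_mul_cotIdealGen j
      have hj : (j + 2 : ℚ) ≠ 0 := by positivity
      have h' : zetaSeries ^ (j + 1) * cotIdealGen = (j + 2 : ℚ)⁻¹ •
          (eulerOp (zetaSeries ^ j * cotIdealGen) -
            (j / 2 + 1 : ℚ) • (zetaSeries ^ j * cotIdealGen) -
            (j / 4 : ℚ) • (piSeries * zetaSeries ^ (j - 1) * cotIdealGen)) := by
        rw [h, eq_inv_smul_iff₀ hj]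
        abel
      rw [h']
      have h0 := ih j (by omega)
      refine Submodule.smul_mem _ _ (sub_mem (sub_mem ?_ ?_) ?_)
      · exact eulerOp_mem_eulerIterateSpan h0
      · exact Submodule.smul_mem _ _ (eulerIterateSpan_mono (by omega) h0)
      · cases j with
        | zero => simp
        | succ j =>
          refine Submodule.smul_mem _ _ ?_
          have h1 := piSeries_pow_mul_mem_eulerIterateSpan (ih j (by omega)) 1
          rw [pow_one, ← mul_assoc] at h1
          exact eulerIterateSpan_mono (by omega) h1

/-- A normal form: modulo the derivatives of `q`, only monomials of degree at most one in `g`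
remain. -/
theorem zetaFiltration_le (n e : ℕ) :
    zetaFiltration n e ≤ Submodule.span ℚ {x | ∃ i, 2 * i ≤ n ∧ x = piSeries ^ i} ⊔
      Submodule.span ℚ {x | ∃ i, 2 * i + 1 ≤ n ∧ x = piSeries ^ i * zetaSeries} ⊔
      eulerIterateSpan (n + e) := by
  have hq : ∀ i j, 2 * i + j + 2 ≤ n + e →
      piSeries ^ i * zetaSeries ^ j * cotIdealGen ∈ eulerIterateSpan (n + e) := by
    intro i j hij
    rw [mul_assoc]
    exact eulerIterateSpan_mono (by omega)
      (piSeries_pow_mul_mem_eulerIterateSpan (zetaSeries_pow_mul_cotIdealGen_mem j) i)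
  refine Submodule.span_le.2 ?_
  rintro _ (⟨i, j, hij, rfl⟩ | ⟨i, j, hij, rfl⟩)
  · induction j using Nat.strong_induction_on generalizing i with
    | _ j ih =>
      rcases j with _ | _ | j
      · exact Submodule.mem_sup_left (Submodule.mem_sup_left
          (Submodule.subset_span ⟨i, by omega, by simp⟩))
      · exact Submodule.mem_sup_left (Submodule.mem_sup_right
          (Submodule.subset_span ⟨i, by omega, by simp⟩))
      · rw [show piSeries ^ i * zetaSeries ^ (j + 1 + 1) =
          piSeries ^ i * zetaSeries ^ j * cotIdealGen -
            (1 / 4 : ℚ) • (piSeries ^ (i + 1) * zetaSeries ^ j) by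
            rw [cotIdealGen]
            algebra]
        exact sub_mem (Submodule.mem_sup_right (hq i j (by omega)))
          (Submodule.smul_mem _ _ (ih j (by omega) (i + 1) (by omega)))
  · exact Submodule.mem_sup_right (hq i j hij)

/-! ### Generating series of weighted sums -/

theorem sum_positiveCompositions_succ {M : Type*} [AddCommMonoid M] (n k : ℕ)
    (f : (Fin (n + 1) → ℕ) → M) :
    ∑ κ ∈ positiveCompositions (n + 1) k, f κ =
      ∑ x ∈ (antidiagonal k).filter (fun x => 1 ≤ x.1),
        ∑ κ ∈ positiveCompositions n x.2, f (Fin.cons x.1 κ) := by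
  rw [Finset.sum_sigma']
  refine Finset.sum_nbij' (fun κ => ⟨(κ 0, ∑ i, Fin.tail κ i), Fin.tail κ⟩)
    (fun y => Fin.cons y.1.1 y.2) ?_ ?_ ?_ ?_ ?_
  · intro κ hκ
    rw [mem_positiveCompositions, Fin.sum_univ_succ] at hκ
    simp only [Finset.mem_sigma, Finset.mem_filter, mem_antidiagonal, mem_positiveCompositions]
    exact ⟨⟨hκ.1, hκ.2 0⟩, trivial, fun i => hκ.2 i.succ⟩
  · rintro ⟨⟨a, b⟩, κ⟩ h
    simp only [Finset.mem_sigma, Finset.mem_filter, mem_antidiagonal, mem_positiveCompositions]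
      at h ⊢
    obtain ⟨⟨rfl, ha⟩, rfl, hκ⟩ := h
    exact ⟨by simp [Fin.sum_univ_succ], Fin.cases ha hκ⟩
  · intro κ _
    simp
  · rintro ⟨⟨a, b⟩, κ⟩ h
    simp only [Finset.mem_sigma, mem_positiveCompositions] at h
    obtain ⟨_, rfl, _⟩ := h
    simp
  · intro κ _
    simp

/-- Merging a new part `a` with the `j`-th part of a composition: the merged part ranges over all
values greater than `a`. -/
theorem sum_positiveCompositions_add_single {M : Type*} [AddCommMonoid M] (n k : ℕ) (j : Fin n)
    (f : ℕ → (Fin n → ℕ) → M) :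
    ∑ x ∈ (antidiagonal k).filter (fun x => 1 ≤ x.1),
        ∑ κ ∈ positiveCompositions n x.2, f x.1 κ =
      ∑ κ ∈ positiveCompositions n k, ∑ a ∈ Finset.Ico 1 (κ j), f a (κ - Pi.single j a) := by
  rw [Finset.sum_sigma', Finset.sum_sigma']
  have hle : ∀ (κ : Fin n → ℕ) (a : ℕ), a ≤ κ j → Pi.single j a ≤ κ := by
    intro κ a h i
    rcases eq_or_ne i j with rfl | hi
    · simpa using h
    · simp [Pi.single_eq_of_ne hi]
  refine Finset.sum_nbij' (fun y => ⟨y.2 + Pi.single j y.1.1, y.1.1⟩)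
    (fun y => ⟨(y.2, k - y.2), y.1 - Pi.single j y.2⟩) ?_ ?_ ?_ ?_ ?_
  · rintro ⟨⟨a, b⟩, κ⟩ h
    simp only [Finset.mem_sigma, Finset.mem_filter, mem_antidiagonal, mem_positiveCompositions,
      Finset.mem_Ico] at h ⊢
    obtain ⟨⟨rfl, ha⟩, rfl, hκ⟩ := h
    refine ⟨⟨?_, fun i => ?_⟩, ha, ?_⟩
    · simp [Finset.sum_add_distrib, add_comm]
    · exact (hκ i).trans (by simp)
    · have := hκ j
      simp
      omega
  · rintro ⟨κ, a⟩ h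
    simp only [Finset.mem_sigma, Finset.mem_filter, mem_antidiagonal, mem_positiveCompositions,
      Finset.mem_Ico] at h ⊢
    obtain ⟨⟨rfl, hκ⟩, ha, haj⟩ := h
    have h1 : ∑ i, (κ - Pi.single j a : Fin n → ℕ) i + a = ∑ i, κ i := by
      conv_rhs => rw [← tsub_add_cancel_of_le (hle κ a haj.le)]
      simp only [Pi.add_apply, Finset.sum_add_distrib]
      simp
    refine ⟨⟨by omega, ha⟩, by omega, fun i => ?_⟩
    rcases eq_or_ne i j with rfl | hi
    · simp
      omega
    · simpa [Pi.single_eq_of_ne hi] using hκ i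
  · rintro ⟨⟨a, b⟩, κ⟩ h
    simp only [Finset.mem_sigma, Finset.mem_filter, mem_antidiagonal] at h
    obtain ⟨⟨rfl, _⟩, _⟩ := h
    simp
  · rintro ⟨κ, a⟩ h
    simp only [Finset.mem_sigma, Finset.mem_Ico] at h
    simp [tsub_add_cancel_of_le (hle κ a h.2.2.le)]
  · rintro ⟨⟨a, b⟩, κ⟩ _
    simp

/-- Faulhaber's formula for the sums `∑ aᵠ (x - a)ᵖ` over `1 ≤ a < x`. -/
theorem exists_polynomial_sum_Ico_pow_mul_pow (p q : ℕ) :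
    ∃ P : ℚ[X], P.natDegree ≤ p + q + 1 ∧ ∀ x : ℕ, 1 ≤ x →
      P.eval (x : ℚ) = ∑ a ∈ Finset.Ico 1 x, (a : ℚ) ^ q * ((x : ℚ) - a) ^ p := by
  induction p generalizing q with
  | zero =>
    refine ⟨∑ i ∈ Finset.range (q + 1),
      Polynomial.C (bernoulli i * ((q + 1).choose i) / (q + 1)) * Polynomial.X ^ (q + 1 - i) -
        Polynomial.C (if q = 0 then 1 else 0), ?_, ?_⟩
    · refine (Polynomial.natDegree_sub_le _ _).trans (max_le ?_ (by split_ifs <;> simp))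
      refine Polynomial.natDegree_sum_le_of_forall_le _ _ fun i _ => ?_
      exact (Polynomial.natDegree_C_mul_X_pow_le _ _).trans (by omega)
    · intro x hx
      have h := sum_range_pow x q
      rw [Finset.range_eq_Ico, Finset.sum_eq_sum_Ico_succ_bot (by omega)] at h
      have h0 : ((0 : ℕ) : ℚ) ^ q = if q = 0 then 1 else 0 := by
        simp [zero_pow_eq]
      simp only [pow_zero, mul_one]
      rw [Polynomial.eval_sub, Polynomial.eval_finsetSum, Polynomial.eval_C, ← h0,
        sub_eq_iff_eq_add', h]
      refine Finset.sum_congr rfl fun i _ => ?_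
      simp only [Polynomial.eval_mul, Polynomial.eval_C, Polynomial.eval_pow, Polynomial.eval_X]
      ring
  | succ p ih =>
    obtain ⟨P, hP, hP'⟩ := ih q
    obtain ⟨Q, hQ, hQ'⟩ := ih (q + 1)
    refine ⟨Polynomial.X * P - Q, ?_, ?_⟩
    · refine (Polynomial.natDegree_sub_le _ _).trans (max_le ?_ (by omega))
      refine Polynomial.natDegree_mul_le.trans ?_
      rw [Polynomial.natDegree_X]
      omega
    · intro x hx
      rw [Polynomial.eval_sub, Polynomial.eval_mul, Polynomial.eval_X, hP' x hx, hQ' x hx,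
        Finset.mul_sum, ← Finset.sum_sub_distrib]
      exact Finset.sum_congr rfl fun a _ => by ring

/-- The generating series in `k` of the sums of `κ₁ ^ p₁ ⋯ κₙ ^ pₙ` times the symmetrised zeta
value of `2κ` over the compositions `κ` of `k`. -/
noncomputable def weightedSeries (ε : ℝ) {n : ℕ} (p : Fin n → ℕ) : PowerSeries ℝ :=
  PowerSeries.mk fun k => ∑ κ ∈ positiveCompositions n k,
    (∏ i, (κ i : ℝ) ^ p i) * symZeta ε fun i => 2 * κ i

theorem coeff_zetaSeries_add_half (q a : ℕ) :
    PowerSeries.coeff a (eulerOp^[q] (zetaSeries + (1 / 2 : ℚ) • 1)) =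
      if 1 ≤ a then (a : ℝ) ^ q * zetaEven a else 0 := by
  rw [coeff_eulerOp_iterate, map_add, coeff_ratSMul, PowerSeries.coeff_one, zetaSeries,
    PowerSeries.coeff_mk]
  rcases Nat.eq_zero_or_pos a with rfl | (ha : 1 ≤ a)
  · norm_num [zetaEven_zero]
  · rw [if_pos ha, if_neg (by omega)]
    simp

theorem coeff_weightedSeries_update (ε : ℝ) {n : ℕ} (p : Fin n → ℕ) (j : Fin n) (P : ℚ[X])
    (k : ℕ) :
    PowerSeries.coeff k (∑ d ∈ Finset.range (P.natDegree + 1),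
        P.coeff d • weightedSeries ε (Function.update p j d)) =
      ∑ κ ∈ positiveCompositions n k, ((P.eval (κ j : ℚ) : ℚ) : ℝ) *
        (∏ i ∈ Finset.univ.erase j, (κ i : ℝ) ^ p i) * symZeta ε fun i => 2 * κ i := by
  rw [map_sum]
  simp only [coeff_ratSMul, weightedSeries, PowerSeries.coeff_mk, Finset.mul_sum]
  rw [Finset.sum_comm]
  refine Finset.sum_congr rfl fun κ _ => ?_
  rw [Polynomial.eval_eq_sum_range]
  push_cast
  rw [Finset.sum_mul, Finset.sum_mul]
  refine Finset.sum_congr rfl fun d _ => ?_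
  rw [← Finset.mul_prod_erase Finset.univ _ (Finset.mem_univ j), Function.update_self]
  rw [Finset.prod_congr rfl fun i hi => by
    rw [Function.update_of_ne (Finset.ne_of_mem_erase hi)]]
  ring

/-- `symZeta_cons` for even arguments, with the first part and its weight split off. -/
theorem prod_pow_mul_symZeta_cons (ε : ℝ) {n : ℕ} (q : ℕ) (p : Fin n → ℕ) (a : ℕ)
    (κ : Fin n → ℕ) (ha : 1 ≤ a) (hκ : ∀ i, 1 ≤ κ i) :
    (∏ i, (((Fin.cons a κ : Fin (n + 1) → ℕ) i : ℕ) : ℝ) ^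
          (Fin.cons q p : Fin (n + 1) → ℕ) i) *
        symZeta ε (fun i => 2 * (Fin.cons a κ : Fin (n + 1) → ℕ) i) =
      (a : ℝ) ^ q * zetaEven a * ((∏ i, (κ i : ℝ) ^ p i) * symZeta ε fun i => 2 * κ i) +
        ε * ∑ j, (a : ℝ) ^ q * (∏ i, (κ i : ℝ) ^ p i) *
          symZeta ε (fun i => 2 * (κ + Pi.single j a : Fin n → ℕ) i) := by
  have h1 : (fun i => 2 * (Fin.cons a κ : Fin (n + 1) → ℕ) i) =
      (Fin.cons (2 * a) (fun i => 2 * κ i) : Fin (n + 1) → ℕ) := by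
    ext i
    refine Fin.cases ?_ (fun i => ?_) i <;> simp
  have h2 : ∀ j, (fun i => 2 * (κ + Pi.single j a : Fin n → ℕ) i) =
      (fun i => 2 * κ i) + Pi.single j (2 * a) := by
    intro j
    ext i
    rcases eq_or_ne i j with rfl | hi
    · simp [mul_add]
    · simp [Pi.single_eq_of_ne hi]
  rw [h1, symZeta_cons ε _ _ (by omega) (fun i => by have := hκ i; omega),
    tsum_one_div_pow_two_mul (by omega), Fin.prod_univ_succ]
  simp only [Fin.cons_zero, Fin.cons_succ, h2, ← Finset.mul_sum]
  ring

theorem sum_prod_pow_mul_symZeta_add_single (ε : ℝ) {n : ℕ} (q : ℕ) (p : Fin n → ℕ) (j : Fin n)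
    (P : ℚ[X]) (hP : ∀ x : ℕ, 1 ≤ x →
      P.eval (x : ℚ) = ∑ a ∈ Finset.Ico 1 x, (a : ℚ) ^ q * ((x : ℚ) - a) ^ p j) (k : ℕ) :
    ∑ x ∈ (antidiagonal k).filter (fun x => 1 ≤ x.1),
        ∑ κ ∈ positiveCompositions n x.2, (x.1 : ℝ) ^ q * (∏ i, (κ i : ℝ) ^ p i) *
          symZeta ε (fun i => 2 * (κ + Pi.single j x.1 : Fin n → ℕ) i) =
      ∑ κ ∈ positiveCompositions n k, ((P.eval (κ j : ℚ) : ℚ) : ℝ) *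
        (∏ i ∈ Finset.univ.erase j, (κ i : ℝ) ^ p i) * symZeta ε fun i => 2 * κ i := by
  have hmerge := sum_positiveCompositions_add_single n k j
    fun (a : ℕ) (κ : Fin n → ℕ) => (a : ℝ) ^ q * (∏ i, (κ i : ℝ) ^ p i) *
      symZeta ε (fun i => 2 * (κ + Pi.single j a : Fin n → ℕ) i)
  rw [hmerge]
  refine Finset.sum_congr rfl fun κ hκ => ?_
  have hκ1 := (mem_positiveCompositions.1 hκ).2
  rw [hP _ (hκ1 j)]
  push_cast
  rw [Finset.sum_mul, Finset.sum_mul]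
  refine Finset.sum_congr rfl fun a ha => ?_
  have haj := (Finset.mem_Ico.1 ha).2
  have hadd : (κ - Pi.single j a + Pi.single j a : Fin n → ℕ) = κ := by
    refine tsub_add_cancel_of_le fun i => ?_
    rcases eq_or_ne i j with rfl | hi
    · simpa using haj.le
    · simp [Pi.single_eq_of_ne hi]
  have hprod : ∏ i ∈ Finset.univ.erase j, ((κ - Pi.single j a : Fin n → ℕ) i : ℝ) ^ p i =
      ∏ i ∈ Finset.univ.erase j, (κ i : ℝ) ^ p i :=
    Finset.prod_congr rfl fun i hi => by
      rw [Pi.sub_apply, Pi.single_eq_of_ne (Finset.ne_of_mem_erase hi), Nat.sub_zero]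
  rw [hadd, ← Finset.mul_prod_erase Finset.univ _ (Finset.mem_univ j), hprod, Pi.sub_apply,
    Pi.single_eq_same, Nat.cast_sub haj.le]
  ring

/-- The generating-series form of the recursion `symZeta_cons`: the first part is either split off as
a factor or merged with another part, the weights of the two being combined into `P j`. -/
theorem weightedSeries_cons (ε : ℝ) {n : ℕ} (q : ℕ) (p : Fin n → ℕ) (P : Fin n → ℚ[X])
    (hP : ∀ j, ∀ x : ℕ, 1 ≤ x →
      (P j).eval (x : ℚ) = ∑ a ∈ Finset.Ico 1 x, (a : ℚ) ^ q * ((x : ℚ) - a) ^ p j) :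
    weightedSeries ε (Fin.cons q p : Fin (n + 1) → ℕ) =
      eulerOp^[q] (zetaSeries + (1 / 2 : ℚ) • 1) * weightedSeries ε p +
        ε • ∑ j, ∑ d ∈ Finset.range ((P j).natDegree + 1),
          (P j).coeff d • weightedSeries ε (Function.update p j d) := by
  ext k
  rw [map_add, PowerSeries.coeff_smul, map_sum, PowerSeries.coeff_mul]
  simp only [coeff_weightedSeries_update, coeff_zetaSeries_add_half]
  simp only [weightedSeries, PowerSeries.coeff_mk, ite_mul, zero_mul]
  rw [sum_positiveCompositions_succ, ← Finset.sum_filter, Finset.sum_congr rfl fun x hx =>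
    Finset.sum_congr rfl fun κ hκ => prod_pow_mul_symZeta_cons ε q p x.1 κ
      (Finset.mem_filter.1 hx).2 (mem_positiveCompositions.1 hκ).2]
  simp only [Finset.sum_add_distrib, ← Finset.mul_sum, smul_eq_mul]
  congr 2
  simp only [← sum_prod_pow_mul_symZeta_add_single ε q p _ (P _) (hP _) k]
  rw [Finset.sum_comm]
  refine Finset.sum_congr rfl fun x _ => ?_
  rw [Finset.sum_comm]
  simp only [Finset.mul_sum]

/-- Merging two parts lowers the length by one and raises the degree by at most one, so both terms of
the recursion stay in the same step of the filtration. -/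
theorem weightedSeries_mem_zetaFiltration (ε : ℚ) {n : ℕ} (p : Fin n → ℕ) :
    weightedSeries (ε : ℝ) p ∈ zetaFiltration n (∑ i, p i) := by
  induction n with
  | zero =>
    have h : weightedSeries (ε : ℝ) p = piSeries ^ 0 * zetaSeries ^ 0 := by
      ext k
      rw [weightedSeries, PowerSeries.coeff_mk]
      cases k with
      | zero => simp [positiveCompositions, symZeta_zero]
      | succ k => simp [positiveCompositions, PowerSeries.coeff_one]
    rw [h]
    exact monomial_mem_zetaFiltration _ (by omega)
  | succ n ih =>
    obtain ⟨q, p, rfl⟩ : ∃ q p', p = (Fin.cons q p' : Fin (n + 1) → ℕ) :=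
      ⟨p 0, Fin.tail p, (Fin.cons_self_tail p).symm⟩
    choose P hdeg hP using fun j => exists_polynomial_sum_Ico_pow_mul_pow (p j) q
    rw [weightedSeries_cons ε q p P hP, Fin.sum_univ_succ]
    simp only [Fin.cons_zero, Fin.cons_succ]
    refine add_mem ?_ ?_
    · have h0 : zetaSeries + (1 / 2 : ℚ) • 1 ∈ zetaFiltration 1 0 := by
        have h1 : piSeries ^ 0 * zetaSeries ^ 1 ∈ zetaFiltration 1 0 :=
          monomial_mem_zetaFiltration 0 (by omega)
        have h2 : piSeries ^ 0 * zetaSeries ^ 0 ∈ zetaFiltration 1 0 :=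
          monomial_mem_zetaFiltration 0 (by omega)
        simp only [pow_zero, pow_one, one_mul] at h1 h2
        exact add_mem h1 (Submodule.smul_mem _ _ h2)
      exact zetaFiltration_mono (by omega) (by omega)
        (mul_mem_zetaFiltration (eulerOp_iterate_mem_zetaFiltration h0 q) (ih p))
    · rw [Rat.cast_smul_eq_qsmul]
      refine Submodule.smul_mem _ _ (sum_mem fun j _ => sum_mem fun d hd => ?_)
      refine Submodule.smul_mem _ _ ?_
      have hd' : d ≤ p j + q + 1 := (Nat.lt_succ_iff.1 (Finset.mem_range.1 hd)).trans (hdeg j)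
      have hs : ∑ i, Function.update p j d i + p j = ∑ i, p i + d := by
        rw [Finset.sum_update_of_mem (Finset.mem_univ j), ← Finset.add_sum_erase Finset.univ p
          (Finset.mem_univ j), Finset.sdiff_singleton_eq_erase]
        ring
      exact zetaFiltration_mono (by omega) (by omega) (ih (Function.update p j d))

theorem mk_sum_eval_mul_symZeta_mem (ε : ℚ) {n : ℕ} (F : MvPolynomial (Fin n) ℚ) :
    (PowerSeries.mk fun k => ∑ κ ∈ positiveCompositions n k,
      ((MvPolynomial.eval (fun i => (κ i : ℚ)) F : ℚ) : ℝ) * symZeta ε fun i => 2 * κ i) ∈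
      zetaFiltration n F.totalDegree := by
  have h : (PowerSeries.mk fun k => ∑ κ ∈ positiveCompositions n k,
      ((MvPolynomial.eval (fun i => (κ i : ℚ)) F : ℚ) : ℝ) * symZeta ε fun i => 2 * κ i) =
      ∑ s ∈ F.support, F.coeff s • weightedSeries (ε : ℝ) s := by
    ext k
    rw [PowerSeries.coeff_mk, map_sum]
    simp only [coeff_ratSMul, weightedSeries, PowerSeries.coeff_mk, Finset.mul_sum]
    rw [Finset.sum_comm]
    refine Finset.sum_congr rfl fun κ _ => ?_
    rw [MvPolynomial.eval_eq']
    push_cast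
    rw [Finset.sum_mul]
    exact Finset.sum_congr rfl fun s _ => by ring
  rw [h]
  refine sum_mem fun s hs => Submodule.smul_mem _ _ ?_
  refine zetaFiltration_mono le_rfl ?_ (weightedSeries_mem_zetaFiltration ε s)
  have := MvPolynomial.le_totalDegree hs
  rw [Finsupp.sum_fintype _ _ (by simp)] at this
  omega

/-! ### Extracting the coefficients -/

/-- The series whose `k`-th coefficient is, for every `k ≥ n`, of the form
`∑ c_l(k) ζ(2l) ζ(2k - 2l)`, where `l ≤ min T k` and the polynomials `c_l` have degree at most
`w - 2l - 1`. -/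
noncomputable def zetaConvolutions (n w T : ℕ) : Submodule ℚ (PowerSeries ℝ) where
  carrier := {x | ∃ c : ℕ → ℚ[X], (∀ l ≤ T, (c l).natDegree ≤ w - 2 * l - 1) ∧ ∀ k, n ≤ k →
    PowerSeries.coeff k x = ∑ l ∈ Finset.range (min T k + 1),
      (((c l).eval (k : ℚ) : ℚ) : ℝ) * zetaEven l * zetaEven (k - l)}
  zero_mem' := ⟨0, by simp, by simp⟩
  add_mem' := by
    rintro x y ⟨c, hc, hx⟩ ⟨d, hd, hy⟩
    refine ⟨c + d, fun l hl => (Polynomial.natDegree_add_le _ _).trans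
      (max_le (hc l hl) (hd l hl)), fun k hk => ?_⟩
    rw [map_add, hx k hk, hy k hk, ← Finset.sum_add_distrib]
    refine Finset.sum_congr rfl fun l _ => ?_
    rw [Pi.add_apply, Polynomial.eval_add]
    push_cast
    ring
  smul_mem' := by
    rintro a x ⟨c, hc, hx⟩
    refine ⟨fun l => a • c l, fun l hl => (Polynomial.natDegree_smul_le _ _).trans (hc l hl),
      fun k hk => ?_⟩
    rw [coeff_ratSMul, hx k hk, Finset.mul_sum]
    refine Finset.sum_congr rfl fun l _ => ?_
    rw [Polynomial.eval_smul, smul_eq_mul]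
    push_cast
    ring

theorem coeff_piSeries_pow_mul (i : ℕ) (f : PowerSeries ℝ) (k : ℕ) :
    PowerSeries.coeff k (piSeries ^ i * f) =
      if i ≤ k then (Real.pi ^ 2) ^ i * PowerSeries.coeff (k - i) f else 0 := by
  rw [piSeries, mul_pow, ← map_pow, mul_assoc, PowerSeries.coeff_C_mul,
    PowerSeries.coeff_X_pow_mul', mul_ite, mul_zero]

theorem piSeries_pow_mul_mem_zetaConvolutions {n w T i : ℕ} (f : PowerSeries ℝ) (P : ℚ[X])
    (hf : ∀ m, PowerSeries.coeff m f = ((P.eval (m : ℚ) : ℚ) : ℝ) * zetaEven m) (hi : i ≤ T)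
    (hP : P.natDegree ≤ w - 2 * i - 1) : piSeries ^ i * f ∈ zetaConvolutions n w T := by
  obtain ⟨ρ, hρ⟩ := exists_pi_pow_eq_mul_zetaEven i
  refine ⟨fun l => if l = i then Polynomial.C ρ * P.comp (Polynomial.X - Polynomial.C (i : ℚ))
    else 0, ?_, ?_⟩
  · intro l _
    dsimp only
    split_ifs with h
    · subst h
      refine (Polynomial.natDegree_C_mul_le _ _).trans (Polynomial.natDegree_comp_le.trans ?_)
      rwa [Polynomial.natDegree_X_sub_C, mul_one]
    · simp
  · intro k _
    rw [coeff_piSeries_pow_mul]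
    split_ifs with hik
    · rw [Finset.sum_eq_single i]
      · dsimp only
        rw [if_pos rfl, hf, hρ, Polynomial.eval_mul, Polynomial.eval_C, Polynomial.eval_comp,
          Polynomial.eval_sub, Polynomial.eval_X, Polynomial.eval_C, Nat.cast_sub hik]
        push_cast
        ring
      · intro l _ hl
        simp [hl]
      · intro h
        exact absurd (Finset.mem_range.2 (Nat.lt_succ_of_le (le_min hi hik))) h
    · refine (Finset.sum_eq_zero fun l hl => ?_).symm
      have : l ≠ i := by
        have := Finset.mem_range.1 hl
        omega
      simp [this]

theorem zetaFiltration_le_zetaConvolutions {n r T : ℕ} (hn : 1 ≤ n)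
    (hT : T = max ((r + n - 2) / 2) ((n - 1) / 2)) :
    zetaFiltration n r ≤ zetaConvolutions n (r + n) T := by
  refine (zetaFiltration_le n r).trans (sup_le (sup_le ?_ ?_) ?_) <;> refine Submodule.span_le.2 ?_
  -- The powers of `u` have degree at most `n / 2 < n` in `t`, so they contribute nothing.
  · rintro _ ⟨i, hi, rfl⟩
    refine ⟨0, by simp, fun k hk => ?_⟩
    have h := coeff_piSeries_pow_mul i 1 k
    rw [mul_one, PowerSeries.coeff_one, if_neg (show ¬ k - i = 0 by omega), mul_zero,
      ite_self] at h
    simp [h]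
  · rintro _ ⟨i, hi, rfl⟩
    exact piSeries_pow_mul_mem_zetaConvolutions _ 1 (by simp [zetaSeries]) (by omega) (by simp)
  · rintro _ ⟨i, j, hij, rfl⟩
    refine piSeries_pow_mul_mem_zetaConvolutions _
      (Polynomial.X ^ j * (Polynomial.X - Polynomial.C (1 / 2))) (fun m => ?_) (by omega) ?_
    · have h : cotIdealGen = eulerOp zetaSeries - (1 / 2 : ℚ) • zetaSeries := by
        rw [eulerOp_zetaSeries, add_sub_cancel_right]
      rw [coeff_eulerOp_iterate, h, map_sub, coeff_eulerOp, coeff_ratSMul, zetaSeries,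
        PowerSeries.coeff_mk]
      simp only [Polynomial.eval_mul, Polynomial.eval_pow, Polynomial.eval_X, Polynomial.eval_sub,
        Polynomial.eval_C]
      push_cast
      ring
    · refine Polynomial.natDegree_mul_le.trans ?_
      rw [Polynomial.natDegree_X_pow, Polynomial.natDegree_X_sub_C]
      omega

/-- A symmetric weight sees only the average of `Z` over the permutations of its arguments. -/
theorem sum_eval_mul_eq_average {n : ℕ} (F : MvPolynomial (Fin n) ℚ) (hF : F.IsSymmetric)
    (Z S : (Fin n → ℕ) → ℝ) (k : ℕ)
    (hZ : ∀ κ ∈ positiveCompositions n k, ∑ σ : Equiv.Perm (Fin n), Z (κ ∘ σ) = S κ) :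
    ∑ κ ∈ positiveCompositions n k,
        ((MvPolynomial.eval (fun i => (κ i : ℚ)) F : ℚ) : ℝ) * Z κ =
      (((n.factorial : ℚ)⁻¹ : ℚ) : ℝ) * ∑ κ ∈ positiveCompositions n k,
        ((MvPolynomial.eval (fun i => (κ i : ℚ)) F : ℚ) : ℝ) * S κ := by
  have hσ : ∀ σ : Equiv.Perm (Fin n), ∑ κ ∈ positiveCompositions n k,
        ((MvPolynomial.eval (fun i => (κ i : ℚ)) F : ℚ) : ℝ) * Z (κ ∘ σ) =
      ∑ κ ∈ positiveCompositions n k,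
        ((MvPolynomial.eval (fun i => (κ i : ℚ)) F : ℚ) : ℝ) * Z κ := by
    intro σ
    have hmem : ∀ (τ : Equiv.Perm (Fin n)), ∀ κ ∈ positiveCompositions n k,
        κ ∘ τ ∈ positiveCompositions n k := by
      intro τ κ hκ
      rw [mem_positiveCompositions] at hκ ⊢
      exact ⟨(Equiv.sum_comp τ κ).trans hκ.1, fun i => hκ.2 (τ i)⟩
    refine Finset.sum_nbij' (fun κ => κ ∘ σ) (fun κ => κ ∘ σ.symm) (hmem σ) (hmem σ.symm) ?_ ?_ ?_
    · intro κ _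
      ext i
      simp
    · intro κ _
      ext i
      simp
    · intro κ _
      congr 2
      conv_lhs => rw [← hF σ, MvPolynomial.eval_rename]
      rfl
  have hcard : ∑ σ : Equiv.Perm (Fin n), ∑ κ ∈ positiveCompositions n k,
        ((MvPolynomial.eval (fun i => (κ i : ℚ)) F : ℚ) : ℝ) * Z (κ ∘ σ) =
      n.factorial * ∑ κ ∈ positiveCompositions n k,
        ((MvPolynomial.eval (fun i => (κ i : ℚ)) F : ℚ) : ℝ) * Z κ := by
    rw [Finset.sum_congr rfl fun σ _ => hσ σ, Finset.sum_const, Finset.card_univ,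
      Fintype.card_perm, Fintype.card_fin, nsmul_eq_mul]
  have h0 : (n.factorial : ℝ) ≠ 0 := by exact_mod_cast n.factorial_ne_zero
  push_cast
  rw [eq_inv_mul_iff_mul_eq₀ h0, ← hcard, Finset.sum_comm]
  refine Finset.sum_congr rfl fun κ hκ => ?_
  rw [← Finset.mul_sum, hZ κ hκ]

theorem exists_zetaConvolution {n r T : ℕ} (hn : 1 ≤ n) (F : MvPolynomial (Fin n) ℚ)
    (hF : F.IsSymmetric) (hr : F.totalDegree = r)
    (hT : T = max ((r + n - 2) / 2) ((n - 1) / 2)) (ε : ℚ) (Z : (Fin n → ℕ) → ℝ)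
    (hZ : ∀ κ : Fin n → ℕ, (∀ i, 2 ≤ κ i) →
      ∑ σ : Equiv.Perm (Fin n), Z (fun i => κ (σ i)) = symZeta ε κ) :
    ∃ c : ℕ → ℚ[X], (∀ l ≤ T, (c l).natDegree ≤ r + n - 2 * l - 1) ∧ ∀ k : ℕ, n ≤ k →
      ∑ κ ∈ positiveCompositions n k,
          ((MvPolynomial.eval (fun i => (κ i : ℚ)) F : ℚ) : ℂ) * (Z (fun i => 2 * κ i) : ℂ) =
        ∑ l ∈ Finset.range (min T k + 1), (((c l).eval (k : ℚ) : ℚ) : ℂ) *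
          riemannZeta (2 * (l : ℂ)) * riemannZeta (2 * (k : ℂ) - 2 * (l : ℂ)) := by
  have hmem := mk_sum_eval_mul_symZeta_mem ε F
  rw [hr] at hmem
  obtain ⟨c, hc, hck⟩ := zetaFiltration_le_zetaConvolutions hn hT
    (Submodule.smul_mem _ ((n.factorial : ℚ)⁻¹) hmem)
  refine ⟨c, hc, fun k hk => ?_⟩
  have h1 := sum_eval_mul_eq_average F hF (fun κ => Z fun i => 2 * κ i)
    (fun κ => symZeta ε fun i => 2 * κ i) k fun κ hκ => hZ (fun i => 2 * κ i) fun i => by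
      have := (mem_positiveCompositions.1 hκ).2 i
      omega
  have h2 := hck k hk
  rw [coeff_ratSMul, PowerSeries.coeff_mk, ← h1] at h2
  have h3 := congrArg (fun x : ℝ => (x : ℂ)) h2
  simp only [Complex.ofReal_sum, Complex.ofReal_mul, Complex.ofReal_ratCast] at h3
  rw [h3]
  refine Finset.sum_congr rfl fun l hl => ?_
  have hlk : l ≤ k := by
    have := Finset.mem_range.1 hl
    omega
  rw [riemannZeta_two_mul_eq_zetaEven, ← mul_sub, ← Nat.cast_sub hlk,
    riemannZeta_two_mul_eq_zetaEven]

theorem mainTheorem4 (n r T : ℕ) (hn : 1 ≤ n)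
    (F : MvPolynomial (Fin n) ℚ) (hF : F.IsSymmetric) (hr : F.totalDegree = r)
    (hT : T = max ((r + n - 2) / 2) ((n - 1) / 2)) :
    ∃ c cStar : ℕ → ℚ[X],
      (∀ l ≤ T, (c l).natDegree ≤ r + n - 2 * l - 1 ∧
        (cStar l).natDegree ≤ r + n - 2 * l - 1) ∧
      ∀ k : ℕ, n ≤ k →
        (∑ κ ∈ positiveCompositions n k,
            ((MvPolynomial.eval (fun i => (κ i : ℚ)) F : ℚ) : ℂ) *
              (multiZeta (fun i => 2 * κ i) : ℂ)
          = ∑ l ∈ Finset.range (min T k + 1),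
              (((c l).eval (k : ℚ) : ℚ) : ℂ) *
                riemannZeta (2 * (l : ℂ)) * riemannZeta (2 * (k : ℂ) - 2 * (l : ℂ))) ∧
        (∑ κ ∈ positiveCompositions n k,
            ((MvPolynomial.eval (fun i => (κ i : ℚ)) F : ℚ) : ℂ) *
              (multiZetaStar (fun i => 2 * κ i) : ℂ)
          = ∑ l ∈ Finset.range (min T k + 1),
              (((cStar l).eval (k : ℚ) : ℚ) : ℂ) *
                riemannZeta (2 * (l : ℂ)) * riemannZeta (2 * (k : ℂ) - 2 * (l : ℂ))) := by
  obtain ⟨c, hc, hck⟩ := exists_zetaConvolution hn F hF hr hT (-1) multiZeta fun κ hκ => by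
    rw [sum_perm_multiZeta κ hκ]
    norm_num
  obtain ⟨d, hd, hdk⟩ := exists_zetaConvolution hn F hF hr hT 1 multiZetaStar fun κ hκ => by
    rw [sum_perm_multiZetaStar κ hκ]
    norm_num
  exact ⟨c, d, fun l hl => ⟨hc l hl, hd l hl⟩, fun k hk => ⟨hck k hk, hdk k hk⟩⟩
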